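/- Let $E=(E^0,E^1,r,s)$ be a topological graph: $E^0,E^1$ are locally compact Hausdorff spaces, $r:E^1\to E^0$ is continuous and $s:E^1\to E^0$ is a local homeomorphism. An $s$-section is a set $U\subset E^1$ such that $s|_U$ is a homeomorphism onto its image. For a function $x$ write $\operatorname{osupp}(x)=\{x\ne 0\}$ and $\operatorname{supp}(x)=\overline{\operatorname{osupp}(x)}$. A Toeplitz representation of $E$ in a $C^*$-algebra $B$ is a pair $(\psi,\pi)$ of a linear map $\psi:C_c(E^1)\to B$ and a $*$-homomorphism $\pi:C_0(E^0)\to B$ such that $\psi((f\circ r)\,x)=\pi(f)\psi(x)$; $\psi(x)^*\psi(x)=\pi(\widehat x)$ whenever $\operatorname{supp}(x)$ lies in an open $s$-section, where $\widehat x(s(e))=|x(e)|^2$ for $e\in\operatorname{osupp}(x)$ and $\widehat x=0$ off $s(\operatorname{osupp}(x))$; and $\psi(x)^*\psi(y)=0$ whenever $\operatorname{supp}(x)$, $\operatorname{supp}(y)$ lie in disjoint open $s$-sections. Let $C^*(\psi,\pi)\subset B$ be the $C^*$-subalgebra generated by the images of $\psi$ and $\pi$. Let $(\psi,\pi)$ be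 a Toeplitz representation of $E$. Let $\mathcal B$ be a base for the topology of $E^1$ consisting of open $s$-sections, and let $\mathcal F\subset C_c(E^1)$ be a set of nonnegative functions such that $\operatorname{supp}(x)$ (and hence $\operatorname{osupp}(x)$) is an $s$-section for every $x\in\mathcal F$ and, for every $U\in\mathcal B$, the linear span of $\{x\in\mathcal F:\operatorname{osupp}(x)\subset U\}$ is dense in $C_0(U)$ in the supremum norm. (1) $C^*(\psi,\pi)$ is the closed linear span of the elements $$\psi(x_1)\cdots\psi(x_n)\,\pi(f)\,\psi(y_m)^*\cdots\psi(y_1)^*,$$ where $m,n\ge 0$, $f\in C_c(E^0)$, all $x_i,y_j\in\mathcal F$, each $s(\operatorname{osupp}(x_i))\cap r(\operatorname{osupp}(x_{i+1}))\neq\emptyset$, each $s(\operatorname{osupp}(y_j))\cap r(\operatorname{osupp}(y_{j+1}))\ne\emptyset$, and $s(\operatorname{osupp}(x_n))\cap s(\operatorname{osupp}(y_m))\cap\operatorname{osupp}(f)\neq\emptyset$ (where $s(\operatorname{osupp}(x_n))$, respectively $s(\operatorname{osupp}(y_m))$, is read as $E^0$ if $n=0$, respectively $m=0$). (2) For $n\ge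 1$ let $E^n$ be the set of paths $\mu=\mu_1\cdots\mu_n$ with $s(\mu_i)=r(\mu_{i+1})$, $r(\mu)=r(\mu_1)$, $s(\mu)=s(\mu_n)$; paths of length $0$ are the vertices, with $r=s=\mathrm{id}$. Put $(x_1\diamond\cdots\diamond x_n)(\mu)=\prod_i x_i(\mu_i)$ (the constant $1$ if $n=0$). For functions $x,y$ on $E^n$ such that $s$ is injective on each of $\operatorname{osupp}(x)$ and $\operatorname{osupp}(y)$, let $H(x,y):E^0\to\mathbb C$ be the function with $H(x,y)(s(\mu))=\overline{x(\mu)}\,y(\mu)$ whenever $x(\mu)y(\mu)\neq0$ and which vanishes off $\{s(\mu):x(\mu)y(\mu)\ne0\}$. Let $\psi(w_1)\cdots\psi(w_m)\pi(f)\psi(x_n)^*\cdots\psi(x_1)^*$ and $\psi(y_1)\cdots\psi(y_p)\pi(g)\psi(z_q)^*\cdots\psi(z_1)^*$ be two spanning elements as in (1), with $p\ge n$, and put $x=x_1\diamond\cdots\diamond x_n$, $y=y_1\diamond\cdots\diamond y_n$. Then there exists $k\in C_0(E^0)$ such that $$f(r(\mu))\,H(x,y)(r(\mu))\,(y_{n+1}\diamond\cdots\diamond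 y_p)(\mu)=(y_{n+1}\diamond\cdots\diamond y_p)(\mu)\,k(s(\mu))\qquad\text{for all }\mu\in E^{p-n},$$ and for every such $k$ $$\big(\psi(w_1)\cdots\psi(w_m)\pi(f)\psi(x_n)^*\cdots\psi(x_1)^*\big)\big(\psi(y_1)\cdots\psi(y_p)\pi(g)\psi(z_q)^*\cdots\psi(z_1)^*\big)=\psi(w_1)\cdots\psi(w_m)\psi(y_{n+1})\cdots\psi(y_p)\,\pi(kg)\,\psi(z_q)^*\cdots\psi(z_1)^*.$$ In particular, this product is either zero or again a spanning element as in (1). -/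

import Mathlib

open Set Topology
open scoped ZeroAtInfty CompactlySupported

/-- A topological graph with vertex space `V` and edge space `W`: both spaces are locally compact
Hausdorff, the range map `r` is continuous and the source map `s` is a local homeomorphism. -/
structure TopologicalGraph (V W : Type*)
    [TopologicalSpace V] [LocallyCompactSpace V] [T2Space V]
    [TopologicalSpace W] [LocallyCompactSpace W] [T2Space W] where
  /-- the range map -/
  r : W → V
  /-- the source map -/
  s : W → V
  continuous_r : Continuous r
  isLocalHomeomorph_s : IsLocalHomeomorph s

namespace TopologicalGraph

section Graph

variable {V W : Type*} [TopologicalSpace V] [LocallyCompactSpace V] [T2Space V]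
  [TopologicalSpace W] [LocallyCompactSpace W] [T2Space W] (E : TopologicalGraph V W)

/-- `U` is an `s`-section: the restriction of `s` to `U` is a homeomorphism onto its image. -/
def IsSSection (U : Set W) : Prop := IsEmbedding fun e : U => E.s e

/-- The left action `(f · x)(e) = f(r(e)) x(e)` of `C₀(V)` on `C_c(W)`. -/
noncomputable def leftAct (f : C₀(V, ℂ)) (x : C_c(W, ℂ)) : C_c(W, ℂ) where
  toFun e := f (E.r e) * x e
  continuous_toFun := ((map_continuous f).comp E.continuous_r).mul (map_continuous x)
  hasCompactSupport' := x.hasCompactSupport.mul_left (f := fun e => f (E.r e))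

open Classical in
/-- The function `x̂` on vertices: `x̂(s(e)) = |x(e)|²` whenever `x(e) ≠ 0`, and `x̂(v) = 0` when
`v` is not the source of such an edge. -/
noncomputable def hatFun (x : C_c(W, ℂ)) (v : V) : ℂ :=
  if h : ∃ e, x e ≠ 0 ∧ E.s e = v then ((‖x h.choose‖ ^ 2 : ℝ) : ℂ) else 0

/-- The support of `x` is contained in an open `s`-section. -/
def SuppInOpenSSection (x : C_c(W, ℂ)) : Prop :=
  ∃ U : Set W, IsOpen U ∧ E.IsSSection U ∧ tsupport x ⊆ U

variable {E}

lemma IsSSection.eq_of_s_eq {U : Set W} (hU : E.IsSSection U) {e e' : W} (he : e ∈ U)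
    (he' : e' ∈ U) (h : E.s e = E.s e') : e = e' :=
  congrArg Subtype.val (hU.injective (a₁ := ⟨e, he⟩) (a₂ := ⟨e', he'⟩) h)

lemma hatFun_eq_zero {x : C_c(W, ℂ)} {v : V} (h : ∀ e, x e ≠ 0 → E.s e ≠ v) :
    E.hatFun x v = 0 := by
  rw [hatFun, dif_neg]
  rintro ⟨e, he, hv⟩
  exact h e he hv

lemma hatFun_s {x : C_c(W, ℂ)} {U : Set W} (hU : E.IsSSection U) (hx : tsupport x ⊆ U) {e : W}
    (he : e ∈ U) : E.hatFun x (E.s e) = ((‖x e‖ ^ 2 : ℝ) : ℂ) := by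
  by_cases hxe : x e = 0
  · rw [hatFun_eq_zero, hxe]
    · simp
    · intro e' he' h
      have := hU.eq_of_s_eq (hx (subset_tsupport _ he')) he h
      exact he' (this ▸ hxe)
  · have h : ∃ e', x e' ≠ 0 ∧ E.s e' = E.s e := ⟨e, hxe, rfl⟩
    rw [hatFun, dif_pos h]
    have := hU.eq_of_s_eq (hx (subset_tsupport _ h.choose_spec.1)) he h.choose_spec.2
    rw [this]

lemma hatFun_hasCompactSupport (x : C_c(W, ℂ)) : HasCompactSupport (E.hatFun x) := by
  refine HasCompactSupport.intro
    (x.hasCompactSupport.isCompact.image E.isLocalHomeomorph_s.continuous) ?_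
  intro v hv
  exact hatFun_eq_zero fun e he h => hv ⟨e, subset_tsupport _ he, h⟩

lemma continuous_hatFun {x : C_c(W, ℂ)} (hx : E.SuppInOpenSSection x) :
    Continuous (E.hatFun x) := by
  obtain ⟨U, hUo, hU, hxU⟩ := hx
  rw [continuous_iff_continuousAt]
  intro v
  by_cases hv : v ∈ E.s '' tsupport x
  · obtain ⟨e, he, rfl⟩ := hv
    have hemb : IsOpenEmbedding (fun e : U => E.s e) :=
      .of_continuous_injective_isOpenMap hU.continuous hU.injective
        (E.isLocalHomeomorph_s.isOpenMap.comp hUo.isOpenEmbedding_subtypeVal.isOpenMap)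
    refine (hemb.continuousAt_iff (x := ⟨e, hxU he⟩)).1 ?_
    have : E.hatFun x ∘ (fun e : U => E.s e) = fun a : U => ((‖x a‖ ^ 2 : ℝ) : ℂ) := by
      funext a
      exact hatFun_s hU hxU a.2
    rw [this]
    have hc : Continuous x := map_continuous x
    exact Continuous.continuousAt (by fun_prop)
  · have hK : IsClosed (E.s '' tsupport x) :=
      (x.hasCompactSupport.isCompact.image E.isLocalHomeomorph_s.continuous).isClosed
    refine (continuousAt_const (y := (0 : ℂ))).congr ?_
    filter_upwards [hK.isOpen_compl.mem_nhds hv] with u hu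
    exact (hatFun_eq_zero fun e he h => hu ⟨e, subset_tsupport _ he, h⟩).symm

variable (E)

/-- `x̂` as an element of `C₀(V)`, for `x` supported in an open `s`-section. -/
noncomputable def hat (x : C_c(W, ℂ)) (hx : E.SuppInOpenSSection x) : C₀(V, ℂ) where
  toFun := E.hatFun x
  continuous_toFun := continuous_hatFun hx
  zero_at_infty' := (hatFun_hasCompactSupport x).is_zero_at_infty

/-- The space `Eⁿ` of paths `μ = μ₁ … μₙ` with `s(μᵢ) = r(μᵢ₊₁)`. The visited vertices are
recorded as well (they are determined by the edges when `n ≥ 1`), so that a path of length `0` is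
a vertex. -/
structure Path (n : ℕ) where
  /-- the vertices `r(μ₁), s(μ₁) = r(μ₂), …, s(μₙ)` -/
  vertex : Fin (n + 1) → V
  /-- the edges `μ₁, …, μₙ` -/
  edge : Fin n → W
  r_edge : ∀ i, E.r (edge i) = vertex i.castSucc
  s_edge : ∀ i, E.s (edge i) = vertex i.succ

variable {E}

/-- The range of a path. -/
def Path.r {n : ℕ} (μ : E.Path n) : V := μ.vertex 0

/-- The source of a path. -/
def Path.s {n : ℕ} (μ : E.Path n) : V := μ.vertex (Fin.last n)

variable (E)

/-- `(x₁ ⋄ ⋯ ⋄ xₙ)(μ) = ∏ xᵢ(μᵢ)`. -/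
noncomputable def diamond {n : ℕ} (x : Fin n → C_c(W, ℂ)) (μ : E.Path n) : ℂ :=
  ∏ i, x i (μ.edge i)

open Classical in
/-- `H(x, y)`, for functions `x, y` on `Eⁿ` supported on `s`-sections: it takes the value
`conj (x(μ)) y(μ)` at `s(μ)` whenever `x(μ) y(μ) ≠ 0`, and `0` at the vertices that are not of
the form `s(μ)` for such `μ`. -/
noncomputable def H {n : ℕ} (x y : E.Path n → ℂ) (v : V) : ℂ :=
  if h : ∃ μ : E.Path n, x μ * y μ ≠ 0 ∧ μ.s = v then
    starRingEnd ℂ (x h.choose) * y h.choose else 0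

variable {E}

lemma H_eq_zero {n : ℕ} {x y : E.Path n → ℂ} {v : V}
    (h : ∀ μ : E.Path n, x μ * y μ ≠ 0 → μ.s ≠ v) : E.H x y v = 0 := by
  rw [H, dif_neg]
  rintro ⟨μ, hμ, hv⟩
  exact h μ hμ hv

lemma H_s {n : ℕ} {x y : E.Path n → ℂ} (hx : ∀ μ ν : E.Path n, x μ ≠ 0 → x ν ≠ 0 → μ.s = ν.s → μ = ν)
    {μ : E.Path n} (hμ : x μ * y μ ≠ 0) : E.H x y μ.s = starRingEnd ℂ (x μ) * y μ := by
  have h : ∃ ν : E.Path n, x ν * y ν ≠ 0 ∧ ν.s = μ.s := ⟨μ, hμ, rfl⟩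
  rw [H, dif_pos h, hx _ μ (left_ne_zero_of_mul h.choose_spec.1) (left_ne_zero_of_mul hμ)
    h.choose_spec.2]

variable (E)

/-- A base `𝓑` of the topology of the edge space consisting of open `s`-sections, and a set `𝓕` of
nonnegative compactly supported functions whose open supports are `s`-sections, such that, for
every `U ∈ 𝓑`, the span of the functions in `𝓕` with open support in `U` is dense in `C₀(U)` in
the supremum norm. -/
structure IsBaseWithFunctions (𝓑 : Set (Set W)) (𝓕 : Set C_c(W, ℂ)) : Prop where
  isBasis : TopologicalSpace.IsTopologicalBasis 𝓑
  isSSection_of_mem : ∀ U ∈ 𝓑, E.IsSSection U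
  nonneg : ∀ x ∈ 𝓕, ∀ e, 0 ≤ (x e).re ∧ (x e).im = 0
  isSSection_osupp : ∀ x ∈ 𝓕, E.IsSSection (Function.support x)
  dense_span : ∀ U ∈ 𝓑, ∀ g : C₀(U, ℂ), ∀ ε > (0 : ℝ),
    ∃ h ∈ Submodule.span ℂ {x | x ∈ 𝓕 ∧ Function.support x ⊆ U}, ∀ e : U, ‖h e - g e‖ < ε

/-- Consecutive members of the word `x₁, …, xₙ` have compatible open supports:
`s(osupp xᵢ) ∩ r(osupp xᵢ₊₁) ≠ ∅`. -/
def IsComposable {n : ℕ} (x : Fin n → C_c(W, ℂ)) : Prop :=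
  ∀ i j : Fin n, (i : ℕ) + 1 = j →
    (E.s '' Function.support (x i) ∩ E.r '' Function.support (x j)).Nonempty

/-- The set `s(osupp xₙ)` for a word `x₁, …, xₙ`; it is the whole vertex space if `n = 0`. -/
def lastSource {n : ℕ} (x : Fin n → C_c(W, ℂ)) : Set V :=
  {v | ∀ i : Fin n, (i : ℕ) + 1 = n → v ∈ E.s '' Function.support (x i)}

/-- The data `(x₁, …, xₙ; f; y₁, …, yₘ)` that index the spanning elements. -/
structure IsSpanningData (𝓕 : Set C_c(W, ℂ)) {n m : ℕ} (x : Fin n → C_c(W, ℂ)) (f : C₀(V, ℂ))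
    (y : Fin m → C_c(W, ℂ)) : Prop where
  left_mem : ∀ i, x i ∈ 𝓕
  right_mem : ∀ j, y j ∈ 𝓕
  hasCompactSupport : HasCompactSupport f
  left_composable : E.IsComposable x
  right_composable : E.IsComposable y
  middle : (E.lastSource x ∩ E.lastSource y ∩ Function.support f).Nonempty

/-- A Toeplitz representation `(ψ, π)` of a topological graph in a C⋆-algebra `B`. -/
structure ToeplitzRep (B : Type*) [NonUnitalCStarAlgebra B] where
  /-- the linear map on `C_c(W)` -/
  ψ : C_c(W, ℂ) →ₗ[ℂ] B
  /-- the homomorphism on `C₀(V)` -/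
  π : C₀(V, ℂ) →⋆ₙₐ[ℂ] B
  map_leftAct : ∀ (f : C₀(V, ℂ)) (x : C_c(W, ℂ)), ψ (E.leftAct f x) = π f * ψ x
  map_hat : ∀ (x : C_c(W, ℂ)) (hx : E.SuppInOpenSSection x), π (E.hat x hx) = star (ψ x) * ψ x
  star_mul_eq_zero : ∀ (x y : C_c(W, ℂ)) (U U' : Set W), IsOpen U → IsOpen U' →
    E.IsSSection U → E.IsSSection U' → Disjoint U U' → tsupport x ⊆ U → tsupport y ⊆ U' →
    star (ψ x) * ψ y = 0

end Graph

namespace ToeplitzRep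

variable {V W : Type*} [TopologicalSpace V] [LocallyCompactSpace V] [T2Space V]
  [TopologicalSpace W] [LocallyCompactSpace W] [T2Space W] {E : TopologicalGraph V W}
  {B : Type*} [NonUnitalCStarAlgebra B] (ρ : E.ToeplitzRep B)

/-- The C⋆-subalgebra `C*(ψ, π)` of `B` generated by the images of `ψ` and `π`. -/
noncomputable def cstar : NonUnitalStarSubalgebra ℂ B :=
  (NonUnitalStarAlgebra.adjoin ℂ (range ρ.ψ ∪ range ρ.π)).topologicalClosure

/-- The element `ψ(x₁) ⋯ ψ(xₙ) π(f) ψ(yₘ)* ⋯ ψ(y₁)*` of `B`. -/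
noncomputable def word {n m : ℕ} (x : Fin n → C_c(W, ℂ)) (f : C₀(V, ℂ))
    (y : Fin m → C_c(W, ℂ)) : B :=
  (List.ofFn fun i => ρ.ψ (x i)).foldr (fun a b => a * b)
    ((List.ofFn fun j => star (ρ.ψ (y j))).foldr (fun a b => b * a) (ρ.π f))

/-- The set of spanning elements built from `𝓕`. -/
def spanningElements (𝓕 : Set C_c(W, ℂ)) : Set B :=
  {b | ∃ (n m : ℕ) (x : Fin n → C_c(W, ℂ)) (f : C₀(V, ℂ)) (y : Fin m → C_c(W, ℂ)),
    E.IsSpanningData 𝓕 x f y ∧ b = ρ.word x f y}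

end ToeplitzRep

end TopologicalGraph

/-! Everything rests on one relation: if `x` is supported in an open `s`-section, then `ψ(x)* ψ(y) =
π(⟨x, y⟩)` for every `y` (`exists_inner`). A partition of unity reduces it to `y` of small support,
where either polarization of `map_hat` or the disjointness relation applies.

Iterating from the innermost pair outwards collapses `ψ(xₙ)* ⋯ ψ(x₁)* π(a) ψ(y₁) ⋯ ψ(yₙ)` to `π(h)`,
with `h` an inner product of functions on paths (`exists_isInner`). This is the source of `H`. The
remaining `π(F)` is carried past the other `ψ(yᵢ)`: by the C⋆-identity the commutation relation
reduces to an identity between four such inner products (`pi_mul_leftWord`). Together these give the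
product formula `word_mul_word`.

The C⋆-identity also shows that a word violating one of the nonemptiness conditions is zero, so the
span of the admissible words is closed under products and adjoints. Its closure contains the image
of `π` by cutting off, and that of `ψ` because `‖ψ(x)‖` is bounded by the sup norm of `x` for
supports in an open `s`-section (`norm_psi_le`), so density of the span of `𝓕` suffices locally. -/

namespace TopologicalGraph

/-! ### Cut-offs and partitions of unity. -/

section Functions

variable {X : Type*} [TopologicalSpace X]

/-- The product of a continuous function with a compactly supported one. -/
noncomputable def cutoff (φ : C(X, ℝ)) (x : C_c(X, ℂ)) : C_c(X, ℂ) where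
  toFun e := (φ e : ℂ) * x e
  continuous_toFun := (Complex.continuous_ofReal.comp φ.continuous).mul (map_continuous x)
  hasCompactSupport' := x.hasCompactSupport.mul_left (f := fun e => (φ e : ℂ))

@[simp] lemma cutoff_apply (φ : C(X, ℝ)) (x : C_c(X, ℂ)) (e : X) :
    cutoff φ x e = (φ e : ℂ) * x e := rfl

lemma tsupport_cutoff_subset (φ : C(X, ℝ)) (x : C_c(X, ℂ)) :
    tsupport (cutoff φ x) ⊆ tsupport φ :=
  closure_mono fun e he h => he (by rw [cutoff_apply, h, Complex.ofReal_zero, zero_mul])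

variable [LocallyCompactSpace X] [T2Space X]

/-- An additive predicate on `C_c(X)` that holds for all functions with sufficiently small support
around each point holds for all functions. -/
lemma compactlySupported_induction {P : C_c(X, ℂ) → Prop} (zero : P 0)
    (add : ∀ x y, P x → P y → P (x + y))
    (loc : ∀ e, ∃ U : Set X, IsOpen U ∧ e ∈ U ∧ ∀ x : C_c(X, ℂ), tsupport x ⊆ U → P x)
    (x : C_c(X, ℂ)) : P x := by
  choose U hUo hU hP using loc
  obtain ⟨t, ht⟩ := x.hasCompactSupport.isCompact.elim_finite_subcover U hUo
    fun e _ => mem_iUnion.2 ⟨e, hU e⟩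
  let c : Fin t.card → X := fun i => t.equivFin.symm i
  obtain ⟨φ, hφ, hsum, -, -⟩ := exists_continuous_sum_one_of_isOpen_isCompact
    (s := fun i => U (c i)) (fun i => hUo _) x.hasCompactSupport.isCompact (by
      intro e he
      obtain ⟨a, ha, hea⟩ := mem_iUnion₂.1 (ht he)
      exact mem_iUnion.2 ⟨t.equivFin ⟨a, ha⟩, by simpa [c] using hea⟩)
  have hx : x = ∑ i, cutoff (φ i) x := by
    ext e
    rw [CompactlySupportedContinuousMap.sum_apply]
    simp only [cutoff_apply]
    rw [← Finset.sum_mul, ← Complex.ofReal_sum]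
    by_cases he : x e = 0
    · simp [he]
    · have := hsum (subset_tsupport _ he)
      simp only [Finset.sum_apply, Pi.one_apply] at this
      simp [this]
  rw [hx]
  exact Finset.sum_induction _ P add zero fun i _ =>
    hP _ _ ((tsupport_cutoff_subset _ _).trans (hφ i))

/-- A compactly supported cut-off function which is `1` on a compact set. -/
lemma exists_zeroAtInfty_eq_one {K : Set X} (hK : IsCompact K) :
    ∃ a : C₀(X, ℂ), HasCompactSupport a ∧ (∀ v ∈ K, a v = 1) ∧ ∀ v, ‖1 - a v‖ ≤ 1 := by
  obtain ⟨f, hf, -, hfc, hf01⟩ :=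
    exists_continuous_one_zero_of_isCompact hK isClosed_empty (disjoint_empty K)
  have hc : HasCompactSupport fun v => (f v : ℂ) :=
    hfc.comp_left (g := ((↑) : ℝ → ℂ)) Complex.ofReal_zero
  refine ⟨⟨⟨fun v => (f v : ℂ), Complex.continuous_ofReal.comp f.continuous⟩,
    hc.is_zero_at_infty⟩, hc, fun v hv => ?_, fun v => ?_⟩
  · have := hf hv
    simp only [Pi.one_apply] at this
    simp [this]
  · have := hf01 v
    change ‖(1 : ℂ) - (f v : ℂ)‖ ≤ 1
    rw [← Complex.ofReal_one, ← Complex.ofReal_sub, Complex.norm_real, Real.norm_eq_abs, abs_le]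
    constructor <;> linarith [this.1, this.2]

lemma exists_hasCompactSupport_norm_sub_le (f : C₀(X, ℂ)) {ε : ℝ} (hε : 0 < ε) :
    ∃ g : C₀(X, ℂ), HasCompactSupport g ∧ ‖f - g‖ ≤ ε := by
  have hev : ∀ᶠ v in Filter.cocompact X, ‖f v‖ < ε := by
    have := (zero_at_infty f).norm
    rw [norm_zero] at this
    exact this.eventually_lt_const hε
  obtain ⟨K, hK, hKf⟩ := Filter.mem_cocompact.1 hev
  obtain ⟨a, hac, ha, ha'⟩ := exists_zeroAtInfty_eq_one hK
  refine ⟨a * f, hac.mul_right (f' := f), ?_⟩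
  rw [← ZeroAtInftyContinuousMap.norm_toBCF_eq_norm,
    BoundedContinuousFunction.norm_le hε.le]
  intro v
  change ‖f v - a v * f v‖ ≤ ε
  by_cases hv : v ∈ K
  · simp [ha v hv, hε.le]
  · rw [← one_sub_mul, norm_mul]
    have h1 : ‖f v‖ < ε := hKf hv
    nlinarith [ha' v, norm_nonneg (f v), norm_nonneg (1 - a v)]

end Functions

/-! ### Open `s`-sections. -/

section Graph

variable {V W : Type*} [TopologicalSpace V] [LocallyCompactSpace V] [T2Space V]
  [TopologicalSpace W] [LocallyCompactSpace W] [T2Space W] {E : TopologicalGraph V W}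

@[simp] lemma leftAct_apply (f : C₀(V, ℂ)) (x : C_c(W, ℂ)) (e : W) :
    E.leftAct f x e = f (E.r e) * x e := rfl

lemma isSSection_of_injOn {U : Set W} (hU : IsOpen U) (h : InjOn E.s U) : E.IsSSection U :=
  (IsOpenEmbedding.of_continuous_injective_isOpenMap
    (E.isLocalHomeomorph_s.continuous.comp continuous_subtype_val) (injOn_iff_injective.1 h)
    (E.isLocalHomeomorph_s.isOpenMap.comp hU.isOpenEmbedding_subtypeVal.isOpenMap)).isEmbedding

lemma IsSSection.mono {U U' : Set W} (hU : E.IsSSection U) (h : U' ⊆ U) : E.IsSSection U' :=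
  hU.comp (IsEmbedding.inclusion h)

lemma exists_isOpen_isSSection (e : W) : ∃ U : Set W, IsOpen U ∧ e ∈ U ∧ E.IsSSection U := by
  obtain ⟨φ, he, hφ⟩ := E.isLocalHomeomorph_s e
  exact ⟨φ.source, φ.open_source, he, isSSection_of_injOn φ.open_source (hφ ▸ φ.injOn)⟩

/-- A continuous, locally injective map that is injective on a compact set is injective on a
neighbourhood of it. The Toeplitz relations need this open section around the closed support. -/
lemma suppInOpenSSection_of_isSSection {x : C_c(W, ℂ)} (h : E.IsSSection (tsupport x)) :
    E.SuppInOpenSSection x := by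
  obtain ⟨t, ht, hinj⟩ := Set.InjOn.exists_mem_nhdsSet (f := E.s) (s := tsupport x)
    (fun e he e' he' hs => h.eq_of_s_eq he he' hs) x.hasCompactSupport.isCompact
    (fun e _ => E.isLocalHomeomorph_s.continuous.continuousAt) fun e _ => by
      obtain ⟨U, hUo, he, hU⟩ := E.exists_isOpen_isSSection e
      exact ⟨U, hUo.mem_nhds he, fun a ha b hb => hU.eq_of_s_eq ha hb⟩
  obtain ⟨U, hUo, hxU, hUt⟩ := mem_nhdsSet_iff_exists.1 ht
  exact ⟨U, hUo, isSSection_of_injOn hUo (hinj.mono hUt), hxU⟩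

lemma hat_s {x : C_c(W, ℂ)} (hx' : E.SuppInOpenSSection x) {U : Set W} (hU : E.IsSSection U)
    (hx : tsupport x ⊆ U) {e : W} (he : e ∈ U) :
    E.hat x hx' (E.s e) = starRingEnd ℂ (x e) * x e := by
  change E.hatFun x (E.s e) = _
  rw [hatFun_s hU hx he, ← Complex.normSq_eq_conj_mul_self, Complex.normSq_eq_norm_sq]

end Graph

/-! ### The inner product relation for single edges. -/

namespace ToeplitzRep

variable {V W : Type*} [TopologicalSpace V] [LocallyCompactSpace V] [T2Space V]
  [TopologicalSpace W] [LocallyCompactSpace W] [T2Space W] {E : TopologicalGraph V W}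
  {B : Type*} [NonUnitalCStarAlgebra B] (ρ : E.ToeplitzRep B)

lemma star_mul_eq_polarization (a b : B) : star a * b =
    (1 / 4 : ℂ) • ((star (a + b) * (a + b) - star (a - b) * (a - b)) -
      Complex.I • (star (a + Complex.I • b) * (a + Complex.I • b) -
        star (a - Complex.I • b) * (a - Complex.I • b))) := by
  simp only [star_add, star_sub, star_smul, add_mul, mul_add, sub_mul, mul_sub, smul_mul_assoc,
    mul_smul_comm, smul_smul, smul_add, smul_sub, Complex.star_def, Complex.conj_I]
  have hI : Complex.I * Complex.I = -1 := Complex.I_mul_I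
  simp only [mul_neg, hI, neg_neg, neg_smul]
  match_scalars <;> ring

/-- The functions `x ± y` and `x ± iy` all live in the same section `U`, so `map_hat` applies to
each, and polarizing in `B` and pointwise in `ℂ` gives matching expressions. -/
lemma exists_inner_of_tsupport_subset {x y : C_c(W, ℂ)} {U : Set W} (hUo : IsOpen U)
    (hU : E.IsSSection U) (hx : tsupport x ⊆ U) (hy : tsupport y ⊆ U) :
    ∃ h : C₀(V, ℂ), (∀ e ∈ U, h (E.s e) = starRingEnd ℂ (x e) * y e) ∧
      (∀ v, v ∉ E.s '' U → h v = 0) ∧ star (ρ.ψ x) * ρ.ψ y = ρ.π h := by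
  have hI : tsupport (Complex.I • y : C_c(W, ℂ)) ⊆ U :=
    (tsupport_smul_subset_right (fun _ => Complex.I) y).trans hy
  have hadd {z : C_c(W, ℂ)} (hz : tsupport z ⊆ U) : tsupport (x + z : C_c(W, ℂ)) ⊆ U :=
    (tsupport_add _ _).trans (union_subset hx hz)
  have hsub {z : C_c(W, ℂ)} (hz : tsupport z ⊆ U) : tsupport (x - z : C_c(W, ℂ)) ⊆ U :=
    (tsupport_sub _ _).trans (union_subset hx hz)
  have hS {z : C_c(W, ℂ)} (hz : tsupport z ⊆ U) : E.SuppInOpenSSection z := ⟨U, hUo, hU, hz⟩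
  have hv0 {z : C_c(W, ℂ)} (hz : tsupport z ⊆ U) {v : V} (hv : v ∉ E.s '' U) :
      E.hat z (hS hz) v = 0 :=
    hatFun_eq_zero fun e he h => hv ⟨e, hz (subset_tsupport _ he), h⟩
  refine ⟨(1 / 4 : ℂ) • ((E.hat (x + y) (hS (hadd hy)) - E.hat (x - y) (hS (hsub hy))) -
      Complex.I • (E.hat (x + Complex.I • y) (hS (hadd hI)) -
        E.hat (x - Complex.I • y) (hS (hsub hI)))), fun e he => ?_, fun v hv => ?_, ?_⟩
  · simp only [ZeroAtInftyContinuousMap.coe_smul, ZeroAtInftyContinuousMap.coe_sub, Pi.smul_apply,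
      Pi.sub_apply]
    rw [hat_s _ hU (hadd hy) he, hat_s _ hU (hsub hy) he, hat_s _ hU (hadd hI) he,
      hat_s _ hU (hsub hI) he]
    simp only [CompactlySupportedContinuousMap.coe_add, CompactlySupportedContinuousMap.coe_sub,
      CompactlySupportedContinuousMap.coe_smul, Pi.add_apply, Pi.sub_apply, Pi.smul_apply,
      smul_eq_mul, map_add, map_sub, map_mul, Complex.conj_I]
    linear_combination ((1 / 2) * starRingEnd ℂ (y e) * x e -
      (1 / 2) * starRingEnd ℂ (x e) * y e) * Complex.I_mul_I
  · simp only [ZeroAtInftyContinuousMap.coe_smul, ZeroAtInftyContinuousMap.coe_sub, Pi.smul_apply,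
      Pi.sub_apply]
    rw [hv0 (hadd hy) hv, hv0 (hsub hy) hv, hv0 (hadd hI) hv, hv0 (hsub hI) hv]
    simp
  · rw [star_mul_eq_polarization]
    simp only [map_smul, map_sub]
    rw [ρ.map_hat, ρ.map_hat, ρ.map_hat, ρ.map_hat]
    simp only [map_smul, map_sub, map_add]

/-- The inner product `⟨x, y⟩` of a function `x` supported in an open `s`-section with an arbitrary
`y`, together with the Toeplitz relation `ψ(x)* ψ(y) = π(⟨x, y⟩)`. -/
lemma exists_inner {x : C_c(W, ℂ)} (hx : E.SuppInOpenSSection x) (y : C_c(W, ℂ)) :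
    ∃ h : C₀(V, ℂ), (∀ e, x e ≠ 0 → h (E.s e) = starRingEnd ℂ (x e) * y e) ∧
      (∀ v, (∀ e, x e ≠ 0 → E.s e ≠ v) → h v = 0) ∧ star (ρ.ψ x) * ρ.ψ y = ρ.π h := by
  obtain ⟨U, hUo, hU, hxU⟩ := hx
  -- A point outside `U` may lie on its boundary; shrinking to a compact `C` leaves such a point a
  -- neighbourhood disjoint from `interior C ⊇ tsupport x`.
  obtain ⟨C, hC, hxC, hCU⟩ := exists_compact_between x.hasCompactSupport.isCompact hUo hxU
  refine compactlySupported_induction (P := fun y => ∃ h : C₀(V, ℂ),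
    (∀ e, x e ≠ 0 → h (E.s e) = starRingEnd ℂ (x e) * y e) ∧
      (∀ v, (∀ e, x e ≠ 0 → E.s e ≠ v) → h v = 0) ∧ star (ρ.ψ x) * ρ.ψ y = ρ.π h)
    ⟨0, by simp, by simp, by simp⟩ ?_ (fun e => ?_) y
  · rintro y y' ⟨h, h1, h2, h3⟩ ⟨h', h1', h2', h3'⟩
    refine ⟨h + h', fun e he => ?_, fun v hv => ?_, ?_⟩
    · simp [h1 e he, h1' e he, mul_add]
    · simp [h2 v hv, h2' v hv]
    · rw [map_add, map_add, mul_add, h3, h3']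
  · by_cases he : e ∈ U
    · refine ⟨U, hUo, he, fun y hy => ?_⟩
      obtain ⟨h, h1, h2, h3⟩ := ρ.exists_inner_of_tsupport_subset hUo hU hxU hy
      refine ⟨h, fun e he => h1 e (hxU (subset_tsupport _ he)), fun v hv => ?_, h3⟩
      by_cases hvU : v ∈ E.s '' U
      · obtain ⟨e, he, rfl⟩ := hvU
        rw [h1 e he, not_not.1 fun hxe => hv e hxe rfl, map_zero, zero_mul]
      · exact h2 v hvU
    · obtain ⟨U', hUo', he', hU'⟩ := E.exists_isOpen_isSSection e
      refine ⟨U' \ C, hUo'.sdiff hC.isClosed, ⟨he', fun h => he (hCU h)⟩, fun y hy => ?_⟩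
      refine ⟨0, fun e hxe => ?_, fun v _ => rfl, ?_⟩
      · have : y e = 0 := by
          by_contra hye
          exact (hy (subset_tsupport _ hye)).2 (interior_subset (hxC (subset_tsupport _ hxe)))
        simp [this]
      · rw [map_zero]
        exact ρ.star_mul_eq_zero x y (interior C) (U' \ C) isOpen_interior
          (hUo'.sdiff hC.isClosed) (hU.mono (interior_subset.trans hCU)) (hU'.mono sdiff_subset)
          (disjoint_sdiff_right.mono_left interior_subset) hxC hy

end ToeplitzRep

end TopologicalGraph

namespace TopologicalGraph

/-! ### Paths and inner products of functions on paths. -/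

section Paths

variable {V W : Type*} [TopologicalSpace V] [LocallyCompactSpace V] [T2Space V]
  [TopologicalSpace W] [LocallyCompactSpace W] [T2Space W] {E : TopologicalGraph V W}

/-- The path of length `0` at a vertex. -/
def Path.nil (v : V) : E.Path 0 := ⟨fun _ => v, Fin.elim0, fun i => i.elim0, fun i => i.elim0⟩

/-- The path obtained by removing the first edge. -/
def Path.tail {n : ℕ} (μ : E.Path (n + 1)) : E.Path n :=
  ⟨fun i => μ.vertex i.succ, fun i => μ.edge i.succ, fun i => μ.r_edge i.succ,
    fun i => μ.s_edge i.succ⟩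

/-- The path obtained by adding an edge at the front. -/
def Path.cons {n : ℕ} (e : W) (μ : E.Path n) (h : E.s e = μ.r) : E.Path (n + 1) where
  vertex := Fin.cons (E.r e) μ.vertex
  edge := Fin.cons e μ.edge
  r_edge i := by
    refine Fin.cases rfl (fun i => ?_) i
    exact μ.r_edge i
  s_edge i := by
    refine Fin.cases h (fun i => ?_) i
    exact μ.s_edge i

lemma Path.r_eq {n : ℕ} (μ : E.Path (n + 1)) : μ.r = E.r (μ.edge 0) := (μ.r_edge 0).symm

lemma Path.s_edge_zero {n : ℕ} (μ : E.Path (n + 1)) : E.s (μ.edge 0) = μ.tail.r := μ.s_edge 0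

lemma Path.s_tail {n : ℕ} (μ : E.Path (n + 1)) : μ.tail.s = μ.s := rfl

lemma diamond_zero (x : Fin 0 → C_c(W, ℂ)) (μ : E.Path 0) : E.diamond x μ = 1 := rfl

lemma diamond_succ {n : ℕ} (x : Fin (n + 1) → C_c(W, ℂ)) (μ : E.Path (n + 1)) :
    E.diamond x μ = x 0 (μ.edge 0) * E.diamond (fun i => x i.succ) μ.tail :=
  Fin.prod_univ_succ _

lemma diamond_cons {n : ℕ} (x : Fin (n + 1) → C_c(W, ℂ)) (e : W) (μ : E.Path n)
    (h : E.s e = μ.r) :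
    E.diamond x (μ.cons e h) = x 0 e * E.diamond (fun i => x i.succ) μ :=
  Fin.prod_univ_succ _

/-- `h` is the inner product of the functions `X` and `Y` on paths, where `X` is supported on an
`s`-section: `h(s(μ)) = conj (X(μ)) Y(μ)` on the open support of `X`. -/
structure IsInner {n : ℕ} (X Y : E.Path n → ℂ) (h : V → ℂ) : Prop where
  apply_s : ∀ μ, X μ ≠ 0 → h μ.s = starRingEnd ℂ (X μ) * Y μ
  eq_zero : ∀ v, (∀ μ, X μ ≠ 0 → μ.s ≠ v) → h v = 0

/-- Where `X ≠ 0` but `Y = 0`, the default value `0` of `H` agrees with the value prescribed for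
`h`. No injectivity is needed, since `h` already has the right value along whichever path `H`
chooses. -/
lemma IsInner.eq_H {n : ℕ} {X Y : E.Path n → ℂ} {h : V → ℂ} (hh : E.IsInner X Y h) (v : V) :
    E.H X Y v = h v := by
  rw [H]
  split_ifs with hv
  · have hs := hv.choose_spec
    rw [← hh.apply_s _ (left_ne_zero_of_mul hs.1), hs.2]
  · by_cases hμ : ∃ μ : E.Path n, X μ ≠ 0 ∧ μ.s = v
    · obtain ⟨μ, hX, rfl⟩ := hμ
      have : Y μ = 0 := by
        by_contra hY
        exact hv ⟨μ, mul_ne_zero hX hY, rfl⟩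
      rw [hh.apply_s μ hX, this, mul_zero]
    · exact (hh.eq_zero v fun μ hX hs => hμ ⟨μ, hX, hs⟩).symm

lemma mem_lastSource_s {n : ℕ} {x : Fin n → C_c(W, ℂ)} {μ : E.Path n} (hμ : E.diamond x μ ≠ 0) :
    μ.s ∈ E.lastSource x := by
  intro i hi
  refine ⟨μ.edge i, fun h => hμ (Finset.prod_eq_zero (Finset.mem_univ i) h), ?_⟩
  rw [μ.s_edge]
  exact congrArg μ.vertex (Fin.ext hi)

end Paths

/-! ### Collapsing words and moving functions along paths. -/

namespace ToeplitzRep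

variable {V W : Type*} [TopologicalSpace V] [LocallyCompactSpace V] [T2Space V]
  [TopologicalSpace W] [LocallyCompactSpace W] [T2Space W] {E : TopologicalGraph V W}
  {B : Type*} [NonUnitalCStarAlgebra B] (ρ : E.ToeplitzRep B)

/-- The element `ψ(x₁) ⋯ ψ(xₙ) b`. -/
noncomputable def leftWord {n : ℕ} (x : Fin n → C_c(W, ℂ)) (b : B) : B :=
  (List.ofFn fun i => ρ.ψ (x i)).foldr (fun a b => a * b) b

@[simp] lemma leftWord_zero (x : Fin 0 → C_c(W, ℂ)) (b : B) : ρ.leftWord x b = b := by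
  simp [leftWord]

lemma leftWord_succ {n : ℕ} (x : Fin (n + 1) → C_c(W, ℂ)) (b : B) :
    ρ.leftWord x b = ρ.ψ (x 0) * ρ.leftWord (fun i => x i.succ) b := by
  simp [leftWord, List.ofFn_succ]

lemma leftWord_mul {n : ℕ} (x : Fin n → C_c(W, ℂ)) (b c : B) :
    ρ.leftWord x (b * c) = ρ.leftWord x b * c := by
  induction n with
  | zero => simp
  | succ n ih => rw [leftWord_succ, leftWord_succ, ih, mul_assoc]

lemma leftWord_zero_right {n : ℕ} (x : Fin n → C_c(W, ℂ)) : ρ.leftWord x 0 = 0 := by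
  simpa using ρ.leftWord_mul x 0 0

lemma leftWord_append {m n : ℕ} (x : Fin m → C_c(W, ℂ)) (y : Fin n → C_c(W, ℂ)) (b : B) :
    ρ.leftWord (Fin.append x y) b = ρ.leftWord x (ρ.leftWord y b) := by
  have h : (fun i => ρ.ψ (Fin.append x y i)) =
      Fin.append (fun i => ρ.ψ (x i)) fun i => ρ.ψ (y i) := by
    funext i
    refine Fin.addCases (fun i => ?_) (fun i => ?_) i <;> simp
  rw [leftWord, h, List.ofFn_fin_append, List.foldr_append]
  rfl

lemma leftWord_split {m n : ℕ} (x : Fin (m + n) → C_c(W, ℂ)) (b : B) :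
    ρ.leftWord x b = ρ.leftWord (fun i => x (Fin.castAdd n i))
      (ρ.leftWord (fun j => x (Fin.natAdd m j)) b) := by
  rw [← leftWord_append, Fin.append_castAdd_natAdd]

/-- Writing the right half as an adjoint lets one theory of left words serve both sides. -/
lemma word_eq {n m : ℕ} (x : Fin n → C_c(W, ℂ)) (f : C₀(V, ℂ)) (y : Fin m → C_c(W, ℂ)) :
    ρ.word x f y = ρ.leftWord x (star (ρ.leftWord y (ρ.π (star f)))) := by
  have h : ∀ l : List B, (l.map star).foldr (fun a b => b * a) (ρ.π f) =
      star (l.foldr (fun a b => a * b) (ρ.π (star f))) := by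
    intro l
    induction l with
    | nil => simp [map_star]
    | cons a l ih => simp [ih]
  rw [word, leftWord, leftWord, ← h, List.map_ofFn]
  rfl

lemma star_word {n m : ℕ} (x : Fin n → C_c(W, ℂ)) (f : C₀(V, ℂ)) (y : Fin m → C_c(W, ℂ)) :
    star (ρ.word x f y) = ρ.word y (star f) x := by
  have h {b : B} {n m : ℕ} (x : Fin n → C_c(W, ℂ)) (y : Fin m → C_c(W, ℂ)) :
      star (ρ.leftWord x (star (ρ.leftWord y b))) = ρ.leftWord y (star (ρ.leftWord x (star b))) := by
    induction m with
    | zero => simp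
    | succ m ih =>
      rw [leftWord_succ, leftWord_succ, star_mul, leftWord_mul, star_mul, star_star, ih]
  rw [word_eq, word_eq, h, star_star, map_star, star_star]

/-- The innermost factor `ψ(x₁)* π(a) ψ(y₁)` is some `π(a')`, and `a'` takes the place of `a` for
the tails; hence the induction is over all `a`. -/
lemma exists_isInner {n : ℕ} {x : Fin n → C_c(W, ℂ)} (hx : ∀ i, E.SuppInOpenSSection (x i))
    (y : Fin n → C_c(W, ℂ)) (a : C₀(V, ℂ)) :
    ∃ h : C₀(V, ℂ), E.IsInner (E.diamond x) (fun μ => a μ.r * E.diamond y μ) h ∧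
      ∀ b c, star (ρ.leftWord x b) * (ρ.π a * ρ.leftWord y c) = star b * (ρ.π h * c) := by
  induction n generalizing a with
  | zero =>
    refine ⟨a, ⟨fun μ _ => ?_, fun v hv => ?_⟩, by simp⟩
    · simp only [diamond_zero, map_one, one_mul, mul_one]
      rfl
    · exact absurd rfl (hv (Path.nil v) (by simp [diamond_zero]))
  | succ n ih =>
    obtain ⟨a', ha1, ha2, ha3⟩ := ρ.exists_inner (hx 0) (E.leftAct a (y 0))
    obtain ⟨h, hh, hw⟩ := ih (fun i => hx i.succ) (fun i => y i.succ) a'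
    refine ⟨h, ⟨fun μ hμ => ?_, fun v hv => ?_⟩, fun b c => ?_⟩
    · rw [diamond_succ] at hμ
      rw [← μ.s_tail, hh.apply_s _ (right_ne_zero_of_mul hμ), ← μ.s_edge_zero,
        ha1 _ (left_ne_zero_of_mul hμ), diamond_succ, diamond_succ, μ.r_eq, leftAct_apply, map_mul]
      ring
    -- If a tail path ends at `v`, no edge in the open support of `x 0` can be prefixed to it, so
    -- `a'` vanishes at the range of that tail.
    · by_cases hv' : ∃ μ : E.Path n, E.diamond (fun i => x i.succ) μ ≠ 0 ∧ μ.s = v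
      · obtain ⟨μ, hμ, rfl⟩ := hv'
        rw [hh.apply_s μ hμ, ha2, zero_mul, mul_zero]
        intro e he hes
        refine hv (μ.cons e hes) ?_ rfl
        rw [diamond_cons]
        exact mul_ne_zero he hμ
      · exact hh.eq_zero v fun μ hμ hs => hv' ⟨μ, hμ, hs⟩
    · rw [leftWord_succ, leftWord_succ, star_mul, ← hw, ← ha3, ρ.map_leftAct]
      simp only [mul_assoc]

/-- `C₀(V)` may lack a unit. A cut-off equal to `1` on the ranges of `tsupport (y 0)` replaces it
and removes `a` from `exists_isInner`; this needs at least one letter. -/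
lemma exists_leftUnit {n : ℕ} (y : Fin (n + 1) → C_c(W, ℂ)) :
    ∃ a : C₀(V, ℂ), (∀ c, ρ.π a * ρ.leftWord y c = ρ.leftWord y c) ∧
      ∀ μ : E.Path (n + 1), a μ.r * E.diamond y μ = E.diamond y μ := by
  obtain ⟨a, -, ha, -⟩ := exists_zeroAtInfty_eq_one
    ((y 0).hasCompactSupport.isCompact.image E.continuous_r)
  have hy (e : W) : a (E.r e) * y 0 e = y 0 e := by
    by_cases he : y 0 e = 0
    · simp [he]
    · rw [ha _ ⟨e, subset_tsupport _ he, rfl⟩, one_mul]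
  refine ⟨a, fun c => ?_, fun μ => ?_⟩
  · rw [leftWord_succ, ← mul_assoc, ← ρ.map_leftAct]
    congr 2
    ext e
    exact hy e
  · rw [diamond_succ, μ.r_eq, ← mul_assoc, hy]

lemma exists_isInner_succ {n : ℕ} {x : Fin (n + 1) → C_c(W, ℂ)}
    (hx : ∀ i, E.SuppInOpenSSection (x i)) (y : Fin (n + 1) → C_c(W, ℂ)) :
    ∃ h : C₀(V, ℂ), E.IsInner (E.diamond x) (E.diamond y) h ∧
      ∀ b c, star (ρ.leftWord x b) * ρ.leftWord y c = star b * (ρ.π h * c) := by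
  obtain ⟨a, ha, ha'⟩ := ρ.exists_leftUnit y
  obtain ⟨h, hh, hw⟩ := ρ.exists_isInner hx y a
  simp only [ha', ha] at hh hw
  exact ⟨h, hh, hw⟩

/-- The element `π(f) (ψ(xₙ)* ⋯ ψ(x₁)* ψ(y₁) ⋯ ψ(yₙ))` is `π(f · H(x, y))`. -/
lemma exists_mul_H {n : ℕ} {x : Fin n → C_c(W, ℂ)} (hx : ∀ i, E.SuppInOpenSSection (x i))
    (y : Fin n → C_c(W, ℂ)) (f : C₀(V, ℂ)) :
    ∃ F : C₀(V, ℂ), (∀ v, F v = f v * E.H (E.diamond x) (E.diamond y) v) ∧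
      ∀ c, star (ρ.leftWord x (ρ.π (star f))) * ρ.leftWord y c = ρ.π F * c := by
  cases n with
  -- Here `H` is the constant `1`, which need not lie in `C₀(V)`; only the product with `f` does.
  | zero =>
    refine ⟨f, fun v => ?_, fun c => by simp [map_star]⟩
    have : E.H (E.diamond x) (E.diamond y) v = 1 := by
      refine IsInner.eq_H (h := fun _ => 1) ⟨fun μ _ => ?_, fun v hv => ?_⟩ v
      · simp [diamond_zero]
      · exact absurd rfl (hv (Path.nil v) (by simp [diamond_zero]))
    rw [this, mul_one]
  | succ n =>
    obtain ⟨h, hh, hw⟩ := ρ.exists_isInner_succ hx y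
    refine ⟨f * h, fun v => ?_, fun c => ?_⟩
    · rw [hh.eq_H]
      rfl
    · rw [hw, map_star, star_star, map_mul, mul_assoc]

/-- The commutation relation `π(F) ψ(y₁) ⋯ ψ(yₗ) = ψ(y₁) ⋯ ψ(yₗ) π(k)`. -/
lemma pi_mul_leftWord {l : ℕ} {y : Fin l → C_c(W, ℂ)} (hy : ∀ i, E.SuppInOpenSSection (y i))
    {F k : C₀(V, ℂ)} (hk : ∀ μ : E.Path l, F μ.r * E.diamond y μ = E.diamond y μ * k μ.s) (c : B) :
    ρ.π F * ρ.leftWord y c = ρ.leftWord y (ρ.π k * c) := by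
  cases l with
  | zero =>
    have : F = k := by
      ext v
      have := hk (Path.nil v)
      rw [diamond_zero, mul_one, one_mul] at this
      exact this
    simp [this]
  | succ l =>
    -- The four inner products that arise on expanding `star T * T` for the difference `T` of the
    -- two sides.
    obtain ⟨h₁, hh₁, hw₁⟩ := ρ.exists_isInner hy y (star F * F)
    obtain ⟨h₂, hh₂, hw₂⟩ := ρ.exists_isInner hy y (star F)
    obtain ⟨h₃, hh₃, hw₃⟩ := ρ.exists_isInner hy y F
    obtain ⟨h₄, hh₄, hw₄⟩ := ρ.exists_isInner_succ hy y
    have hzero : h₁ - h₂ * k - star k * h₃ + star k * h₄ * k = 0 := by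
      ext v
      change h₁ v - h₂ v * k v - star (k v) * h₃ v + star (k v) * h₄ v * k v = 0
      by_cases hv : ∃ μ : E.Path (l + 1), E.diamond y μ ≠ 0 ∧ μ.s = v
      · obtain ⟨μ, hμ, rfl⟩ := hv
        rw [hh₁.apply_s μ hμ, hh₂.apply_s μ hμ, hh₃.apply_s μ hμ, hh₄.apply_s μ hμ]
        have hF : F μ.r = k μ.s := mul_right_cancel₀ hμ ((hk μ).trans (mul_comm _ _))
        simp only [ZeroAtInftyContinuousMap.coe_mul, ZeroAtInftyContinuousMap.coe_star,
          Pi.mul_apply, Pi.star_apply, hF]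
        ring
      · have hv' (μ : E.Path (l + 1)) (hμ : E.diamond y μ ≠ 0) : μ.s ≠ v := fun h => hv ⟨μ, hμ, h⟩
        rw [hh₁.eq_zero v hv', hh₂.eq_zero v hv', hh₃.eq_zero v hv', hh₄.eq_zero v hv']
        simp
    rw [← sub_eq_zero, ← CStarRing.star_mul_self_eq_zero_iff]
    calc star (ρ.π F * ρ.leftWord y c - ρ.leftWord y (ρ.π k * c)) *
          (ρ.π F * ρ.leftWord y c - ρ.leftWord y (ρ.π k * c))
        = star (ρ.leftWord y c) * (ρ.π (star F * F) * ρ.leftWord y c)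
          - star (ρ.leftWord y c) * (ρ.π (star F) * ρ.leftWord y (ρ.π k * c))
          - star (ρ.leftWord y (ρ.π k * c)) * (ρ.π F * ρ.leftWord y c)
          + star (ρ.leftWord y (ρ.π k * c)) * ρ.leftWord y (ρ.π k * c) := by
          simp only [star_sub, star_mul, map_mul, map_star, mul_sub, sub_mul, mul_assoc]
          abel
      _ = star c * (ρ.π (h₁ - h₂ * k - star k * h₃ + star k * h₄ * k) * c) := by
          rw [hw₁, hw₂, hw₃, hw₄]
          simp only [map_add, map_sub, map_mul, map_star, mul_sub, sub_mul, mul_add, add_mul,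
            star_mul, mul_assoc]
      _ = 0 := by rw [hzero, map_zero, zero_mul, mul_zero]

/-- A function on ranges can be moved to sources along the paths in the open support of
`y₁ ⋄ ⋯ ⋄ yₗ`. -/
lemma exists_source_function {l : ℕ} (ρ : E.ToeplitzRep B) {y : Fin l → C_c(W, ℂ)}
    (hy : ∀ i, E.SuppInOpenSSection (y i)) (F : C₀(V, ℂ)) :
    ∃ k : C₀(V, ℂ), ∀ μ : E.Path l, F μ.r * E.diamond y μ = E.diamond y μ * k μ.s := by
  induction l generalizing F with
  | zero => exact ⟨F, fun μ => mul_comm _ _⟩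
  | succ l ih =>
    obtain ⟨U, hUo, hU, hyU⟩ := hy 0
    obtain ⟨C, hC, hyC, hCU⟩ := exists_compact_between (y 0).hasCompactSupport.isCompact hUo hyU
    -- Since `φ = 1` on the support of `y 0` and is supported in the section `U`, the inner product
    -- of `φ` with `F · φ` takes the value `F(r(e))` at `s(e)` for `e` in that support. Its
    -- continuity comes from `exists_inner`.
    obtain ⟨φ, hφ1, hφ0, hφc, -⟩ := exists_continuous_one_zero_of_isCompact
      (y 0).hasCompactSupport.isCompact isOpen_interior.isClosed_compl
      (disjoint_compl_right_iff_subset.2 hyC)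
    let φ' : C_c(W, ℂ) := ⟨⟨fun e => (φ e : ℂ), Complex.continuous_ofReal.comp φ.continuous⟩,
      hφc.comp_left (g := ((↑) : ℝ → ℂ)) Complex.ofReal_zero⟩
    have hφC : tsupport φ' ⊆ C := by
      refine closure_minimal (fun e he => ?_) hC.isClosed
      by_contra heC
      refine he ?_
      have : φ e = 0 := hφ0 fun h => heC (interior_subset h)
      change (φ e : ℂ) = 0
      rw [this, Complex.ofReal_zero]
    obtain ⟨k', hk', -, -⟩ := ρ.exists_inner ⟨U, hUo, hU, hφC.trans hCU⟩ (E.leftAct F φ')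
    obtain ⟨k, hk⟩ := ih (fun i => hy i.succ) k'
    refine ⟨k, fun μ => ?_⟩
    rw [diamond_succ, mul_assoc (y 0 (μ.edge 0)), ← μ.s_tail, ← hk, ← μ.s_edge_zero, μ.r_eq]
    by_cases he : y 0 (μ.edge 0) = 0
    · simp [he]
    · have h1 : φ' (μ.edge 0) = 1 := by
        have := hφ1 (subset_tsupport _ he)
        change ((φ (μ.edge 0) : ℝ) : ℂ) = 1
        rw [this, Pi.one_apply, Complex.ofReal_one]
      rw [hk' _ (by simp [h1]), leftAct_apply, h1]
      simp only [map_one, one_mul, mul_one]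
      ring

end ToeplitzRep

end TopologicalGraph

/-! ### Vanishing words, the product formula and the span. -/

namespace TopologicalGraph

lemma append_natAdd_mem {α : Type*} {S : Set α} {m n l : ℕ} {w : Fin m → α} {y : Fin (n + l) → α}
    (hw : ∀ i, w i ∈ S) (hy : ∀ i, y i ∈ S) (i : Fin (m + l)) :
    Fin.append w (fun j => y (Fin.natAdd n j)) i ∈ S := by
  refine Fin.addCases (fun i => ?_) (fun i => ?_) i
  · rw [Fin.append_left]
    exact hw i
  · rw [Fin.append_right]
    exact hy _

lemma IsSpanningData.symm {V W : Type*} [TopologicalSpace V] [LocallyCompactSpace V] [T2Space V]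
    [TopologicalSpace W] [LocallyCompactSpace W] [T2Space W] {E : TopologicalGraph V W}
    {𝓕 : Set C_c(W, ℂ)} {n m : ℕ} {x : Fin n → C_c(W, ℂ)} {f : C₀(V, ℂ)}
    {y : Fin m → C_c(W, ℂ)} (h : E.IsSpanningData 𝓕 x f y) : E.IsSpanningData 𝓕 y (star f) x where
  left_mem := h.right_mem
  right_mem := h.left_mem
  hasCompactSupport := h.hasCompactSupport.comp_left (g := star) (star_zero ℂ)
  left_composable := h.right_composable
  right_composable := h.left_composable
  middle := by
    obtain ⟨v, ⟨h1, h2⟩, h3⟩ := h.middle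
    exact ⟨v, ⟨h2, h1⟩, star_ne_zero.2 h3⟩

namespace ToeplitzRep

variable {V W : Type*} [TopologicalSpace V] [LocallyCompactSpace V] [T2Space V]
  [TopologicalSpace W] [LocallyCompactSpace W] [T2Space W] {E : TopologicalGraph V W}
  {B : Type*} [NonUnitalCStarAlgebra B] (ρ : E.ToeplitzRep B)

/-- By the C⋆-identity it suffices that `ψ(y)* π(x̂) ψ(y) = 0`, and `x̂ · y = 0` because `x̂`
vanishes on the ranges of the open support of `y`. -/
lemma psi_mul_psi_eq_zero {x y : C_c(W, ℂ)} (hx : E.SuppInOpenSSection x)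
    (h : ¬ (E.s '' Function.support x ∩ E.r '' Function.support y).Nonempty) :
    ρ.ψ x * ρ.ψ y = 0 := by
  have hxy : E.leftAct (E.hat x hx) y = 0 := by
    ext e
    change E.hatFun x (E.r e) * y e = 0
    by_cases he : y e = 0
    · rw [he, mul_zero]
    · rw [hatFun_eq_zero, zero_mul]
      exact fun e' he' hs => h ⟨E.r e, ⟨e', he', hs⟩, e, he, rfl⟩
  rw [← CStarRing.star_mul_self_eq_zero_iff, star_mul, mul_assoc, ← mul_assoc (star (ρ.ψ x)),
    ← ρ.map_hat x hx, ← ρ.map_leftAct, hxy, map_zero, mul_zero]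

lemma isComposable_of_leftWord_ne_zero {n : ℕ} {x : Fin n → C_c(W, ℂ)}
    (hx : ∀ i, E.SuppInOpenSSection (x i)) {b : B} (h : ρ.leftWord x b ≠ 0) :
    E.IsComposable x := by
  induction n with
  | zero => exact fun i => i.elim0
  | succ n ih =>
    rw [leftWord_succ] at h
    have ih' := ih (fun i => hx i.succ) (right_ne_zero_of_mul h)
    intro i j hij
    obtain ⟨j, rfl⟩ := Fin.exists_succ_eq.2 (show j ≠ 0 by rintro rfl; simp at hij)
    induction i using Fin.cases with
    | zero =>
      by_contra hemp
      cases n with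
      | zero => exact j.elim0
      | succ n =>
        have hj : j = 0 := Fin.ext (by simpa using hij.symm)
        subst hj
        rw [leftWord_succ, ← mul_assoc, ρ.psi_mul_psi_eq_zero (hx 0) hemp, zero_mul] at h
        exact h rfl
    | succ i => exact ih' i j (by simpa using hij)

/-- The square `star T * T` is `π(f)* π(h f)`, where `h` vanishes off `lastSource x`. -/
lemma leftWord_pi_eq_zero {n : ℕ} {x : Fin n → C_c(W, ℂ)} (hx : ∀ i, E.SuppInOpenSSection (x i))
    {f : C₀(V, ℂ)} (hf : ∀ v ∈ E.lastSource x, f v = 0) : ρ.leftWord x (ρ.π f) = 0 := by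
  cases n with
  | zero =>
    have : f = 0 := by
      ext v
      exact hf v fun i => i.elim0
    simp [this]
  | succ n =>
    obtain ⟨h, hh, hw⟩ := ρ.exists_isInner_succ hx x
    have hhf : h * f = 0 := by
      ext v
      change h v * f v = 0
      by_cases hv : v ∈ E.lastSource x
      · rw [hf v hv, mul_zero]
      · rw [hh.eq_zero v, zero_mul]
        rintro μ hμ rfl
        exact hv (mem_lastSource_s hμ)
    rw [← CStarRing.star_mul_self_eq_zero_iff, hw, ← map_mul, hhf, map_zero, mul_zero]

/-- For nonempty `x`, `star T * T` contains the left word in `y` ending in `π(star f * a)`, where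
`a` vanishes off `lastSource x`; thus `star f * a` vanishes on `lastSource y`. -/
lemma word_eq_zero {n m : ℕ} {x : Fin n → C_c(W, ℂ)} {f : C₀(V, ℂ)} {y : Fin m → C_c(W, ℂ)}
    (hx : ∀ i, E.SuppInOpenSSection (x i)) (hy : ∀ j, E.SuppInOpenSSection (y j))
    (h : ¬ (E.lastSource x ∩ E.lastSource y ∩ Function.support f).Nonempty) :
    ρ.word x f y = 0 := by
  have hf (v : V) (hv : v ∈ E.lastSource x) (hv' : v ∈ E.lastSource y) : f v = 0 := by
    by_contra hfv
    exact h ⟨v, ⟨hv, hv'⟩, hfv⟩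
  rw [word_eq]
  cases n with
  | zero =>
    rw [ρ.leftWord_pi_eq_zero hy, star_zero, leftWord_zero_right]
    intro v hv
    change star (f v) = 0
    rw [hf v (fun i => i.elim0) hv, star_zero]
  | succ n =>
    obtain ⟨a, ha, hw⟩ := ρ.exists_isInner_succ hx x
    rw [← CStarRing.star_mul_self_eq_zero_iff, hw, star_star, ← mul_assoc, ← leftWord_mul,
      ← map_mul, ρ.leftWord_pi_eq_zero hy, zero_mul]
    intro v hv
    change star (f v) * a v = 0
    by_cases hv' : v ∈ E.lastSource x
    · rw [hf v hv' hv, star_zero, zero_mul]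
    · rw [ha.eq_zero v, mul_zero]
      rintro μ hμ rfl
      exact hv' (mem_lastSource_s hμ)

variable {𝓑 : Set (Set W)} {𝓕 : Set C_c(W, ℂ)}

/-- Nonvanishing forces all three nonemptiness conditions, so they never have to be tracked through
products. -/
lemma word_mem_spanningElements (hsupp : ∀ x ∈ 𝓕, E.SuppInOpenSSection x) {n m : ℕ}
    {x : Fin n → C_c(W, ℂ)} {f : C₀(V, ℂ)} {y : Fin m → C_c(W, ℂ)} (hx : ∀ i, x i ∈ 𝓕)
    (hy : ∀ j, y j ∈ 𝓕) (hf : HasCompactSupport f) (h : ρ.word x f y ≠ 0) :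
    ρ.word x f y ∈ ρ.spanningElements 𝓕 := by
  refine ⟨n, m, x, f, y, ⟨hx, hy, hf, ?_, ?_, ?_⟩, rfl⟩
  · rw [word_eq] at h
    exact ρ.isComposable_of_leftWord_ne_zero (fun i => hsupp _ (hx i)) h
  · rw [word_eq] at h
    refine ρ.isComposable_of_leftWord_ne_zero (fun j => hsupp _ (hy j))
      (b := ρ.π (star f)) fun h0 => h ?_
    rw [h0, star_zero, leftWord_zero_right]
  · by_contra hemp
    exact h (ρ.word_eq_zero (fun i => hsupp _ (hx i)) (fun j => hsupp _ (hy j)) hemp)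

lemma word_mem_span (hsupp : ∀ x ∈ 𝓕, E.SuppInOpenSSection x) {n m : ℕ}
    {x : Fin n → C_c(W, ℂ)} {f : C₀(V, ℂ)} {y : Fin m → C_c(W, ℂ)} (hx : ∀ i, x i ∈ 𝓕)
    (hy : ∀ j, y j ∈ 𝓕) (hf : HasCompactSupport f) :
    ρ.word x f y ∈ Submodule.span ℂ (ρ.spanningElements 𝓕) := by
  by_cases h : ρ.word x f y = 0
  · rw [h]
    exact zero_mem _
  · exact Submodule.subset_span (ρ.word_mem_spanningElements hsupp hx hy hf h)

lemma word_mul_word {m n l q : ℕ} (w : Fin m → C_c(W, ℂ)) (f : C₀(V, ℂ))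
    {x : Fin n → C_c(W, ℂ)} {y : Fin (n + l) → C_c(W, ℂ)} (g : C₀(V, ℂ)) (z : Fin q → C_c(W, ℂ))
    (hx : ∀ i, E.SuppInOpenSSection (x i)) (hy : ∀ i, E.SuppInOpenSSection (y i))
    {k : C₀(V, ℂ)} (hk : ∀ μ : E.Path l,
      (f μ.r * E.H (E.diamond x) (E.diamond fun i => y (Fin.castAdd l i)) μ.r) *
          E.diamond (fun j => y (Fin.natAdd n j)) μ =
        E.diamond (fun j => y (Fin.natAdd n j)) μ * k μ.s) :
    ρ.word w f x * ρ.word y g z =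
      ρ.word (Fin.append w fun j => y (Fin.natAdd n j)) (k * g) z := by
  obtain ⟨F, hF, hFw⟩ := ρ.exists_mul_H hx (fun i => y (Fin.castAdd l i)) f
  simp only [← hF] at hk
  have hkg : star (k * g) = star g * star k := by
    ext v
    exact star_mul (k v) (g v)
  rw [word_eq, word_eq, word_eq, ρ.leftWord_split y, ← leftWord_mul, hFw,
    ρ.pi_mul_leftWord (fun j => hy _) hk, leftWord_append, hkg, map_mul,
    ρ.leftWord_mul z, star_mul, map_star ρ.π k, star_star]

lemma exists_multiplier {n l : ℕ} (ρ : E.ToeplitzRep B) {x : Fin n → C_c(W, ℂ)} {y : Fin (n + l) → C_c(W, ℂ)}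
    (hx : ∀ i, E.SuppInOpenSSection (x i)) (hy : ∀ i, E.SuppInOpenSSection (y i))
    (f : C₀(V, ℂ)) :
    ∃ k : C₀(V, ℂ), ∀ μ : E.Path l,
      (f μ.r * E.H (E.diamond x) (E.diamond fun i => y (Fin.castAdd l i)) μ.r) *
          E.diamond (fun j => y (Fin.natAdd n j)) μ =
        E.diamond (fun j => y (Fin.natAdd n j)) μ * k μ.s := by
  obtain ⟨F, hF, -⟩ := ρ.exists_mul_H hx (fun i => y (Fin.castAdd l i)) f
  obtain ⟨k, hk⟩ := ρ.exists_source_function (fun j => hy (Fin.natAdd n j)) F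
  exact ⟨k, fun μ => by rw [← hF, hk]⟩

lemma word_mul_word_mem_span_of_le (hsupp : ∀ x ∈ 𝓕, E.SuppInOpenSSection x) {m n p q : ℕ}
    (hnp : n ≤ p) {w : Fin m → C_c(W, ℂ)} {f : C₀(V, ℂ)} {x : Fin n → C_c(W, ℂ)}
    {y : Fin p → C_c(W, ℂ)} {g : C₀(V, ℂ)} {z : Fin q → C_c(W, ℂ)}
    (hwx : E.IsSpanningData 𝓕 w f x) (hyz : E.IsSpanningData 𝓕 y g z) :
    ρ.word w f x * ρ.word y g z ∈ Submodule.span ℂ (ρ.spanningElements 𝓕) := by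
  obtain ⟨l, rfl⟩ := Nat.exists_eq_add_of_le hnp
  have hx i := hsupp _ (hwx.right_mem i)
  have hy i := hsupp _ (hyz.left_mem i)
  obtain ⟨k, hk⟩ := ρ.exists_multiplier hx hy f
  rw [ρ.word_mul_word w f g z hx hy hk]
  exact ρ.word_mem_span hsupp (append_natAdd_mem hwx.left_mem hyz.left_mem) hyz.right_mem
    (hyz.hasCompactSupport.mul_left (f := k))

lemma star_mem_span {b : B} (hb : b ∈ Submodule.span ℂ (ρ.spanningElements 𝓕)) :
    star b ∈ Submodule.span ℂ (ρ.spanningElements 𝓕) := by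
  induction hb using Submodule.span_induction with
  | mem b hb =>
    obtain ⟨n, m, x, f, y, h, rfl⟩ := hb
    exact Submodule.subset_span ⟨m, n, y, star f, x, h.symm, ρ.star_word x f y⟩
  | zero => simp
  | add a b _ _ ha hb => rw [star_add]; exact add_mem ha hb
  | smul c b _ hb => rw [star_smul]; exact Submodule.smul_mem _ _ hb

lemma mul_mem_span (hsupp : ∀ x ∈ 𝓕, E.SuppInOpenSSection x) {a b : B}
    (ha : a ∈ Submodule.span ℂ (ρ.spanningElements 𝓕))
    (hb : b ∈ Submodule.span ℂ (ρ.spanningElements 𝓕)) :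
    a * b ∈ Submodule.span ℂ (ρ.spanningElements 𝓕) := by
  induction ha, hb using Submodule.span_induction₂ with
  | mem_mem a b ha hb =>
    obtain ⟨n, m, x, f, y, h, rfl⟩ := ha
    obtain ⟨n', m', x', f', y', h', rfl⟩ := hb
    rcases le_total m n' with hle | hle
    · exact ρ.word_mul_word_mem_span_of_le hsupp hle h h'
    -- The case where the second word has the shorter left half reduces to the other one by taking
    -- adjoints.
    · have := ρ.star_mem_span (ρ.word_mul_word_mem_span_of_le hsupp hle
        h'.symm h.symm)
      rwa [← star_word, ← star_word, star_mul, star_star, star_star] at this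
  | zero_left b _ => simp
  | zero_right a _ => simp
  | add_left a a' b _ _ _ h h' => rw [add_mul]; exact add_mem h h'
  | add_right a b b' _ _ _ h h' => rw [mul_add]; exact add_mem h h'
  | smul_left c a b _ _ h => rw [smul_mul_assoc]; exact Submodule.smul_mem _ _ h
  | smul_right c a b _ _ h => rw [mul_smul_comm]; exact Submodule.smul_mem _ _ h

/-! ### The closed span and the generated C⋆-subalgebra. -/

/-- The closed span of the spanning elements as a star subalgebra. -/
noncomputable def closedSpan (hsupp : ∀ x ∈ 𝓕, E.SuppInOpenSSection x) :
    NonUnitalStarSubalgebra ℂ B :=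
  NonUnitalStarSubalgebra.topologicalClosure
    { Submodule.span ℂ (ρ.spanningElements 𝓕) with
      mul_mem' := ρ.mul_mem_span hsupp
      star_mem' := ρ.star_mem_span }

lemma mem_closedSpan (hsupp : ∀ x ∈ 𝓕, E.SuppInOpenSSection x) {b : B} :
    b ∈ ρ.closedSpan hsupp ↔ b ∈ closure (Submodule.span ℂ (ρ.spanningElements 𝓕) : Set B) :=
  Iff.rfl

lemma pi_mem_closedSpan (hsupp : ∀ x ∈ 𝓕, E.SuppInOpenSSection x) (f : C₀(V, ℂ)) :
    ρ.π f ∈ ρ.closedSpan hsupp := by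
  rw [mem_closedSpan, Metric.mem_closure_iff]
  intro ε hε
  obtain ⟨g, hg, hfg⟩ := exists_hasCompactSupport_norm_sub_le f (half_pos hε)
  refine ⟨ρ.π g, ?_, ?_⟩
  · have := ρ.word_mem_span hsupp (x := Fin.elim0) (y := Fin.elim0) (fun i => i.elim0)
      (fun i => i.elim0) hg
    simpa [word_eq, map_star] using this
  · rw [dist_eq_norm, ← map_sub]
    exact (NonUnitalStarAlgHom.norm_apply_le ρ.π _).trans_lt (by linarith)

lemma psi_mem_span (hsupp : ∀ x ∈ 𝓕, E.SuppInOpenSSection x) {x : C_c(W, ℂ)} (hx : x ∈ 𝓕) :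
    ρ.ψ x ∈ Submodule.span ℂ (ρ.spanningElements 𝓕) := by
  obtain ⟨a, -, ha, -⟩ := exists_zeroAtInfty_eq_one
    (x.hasCompactSupport.isCompact.image E.continuous_r)
  obtain ⟨k, hk, hk1, -⟩ := exists_zeroAtInfty_eq_one
    (x.hasCompactSupport.isCompact.image E.isLocalHomeomorph_s.continuous)
  have hax : E.leftAct a x = x := by
    ext e
    rw [leftAct_apply]
    by_cases he : x e = 0
    · simp [he]
    · rw [ha _ ⟨e, subset_tsupport _ he, rfl⟩, one_mul]
  -- The commutation relation for the one-letter word, with `a` acting as a left unit. Since `B` may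
  -- have no unit, `c` cannot be dropped at once; `hψ` removes it by taking `c` to be the adjoint of
  -- the difference.
  have hxk (c : B) : ρ.ψ x * c = ρ.ψ x * ρ.π k * c := by
    have := ρ.pi_mul_leftWord (y := fun _ : Fin 1 => x) (F := a) (k := k)
      (fun _ => hsupp x hx) (fun μ => by
        rw [diamond_succ, diamond_zero, mul_one, μ.r_eq, ← leftAct_apply, hax]
        by_cases he : x (μ.edge 0) = 0
        · simp [he]
        · have : k μ.s = 1 := hk1 _ ⟨μ.edge 0, subset_tsupport _ he, μ.s_edge 0⟩
          rw [this, mul_one]) c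
    rwa [leftWord_succ, leftWord_succ, leftWord_zero, leftWord_zero, ← mul_assoc, ← mul_assoc,
      ← ρ.map_leftAct, hax] at this
  have hψ : ρ.ψ x = ρ.ψ x * ρ.π k := by
    rw [← sub_eq_zero, ← CStarRing.mul_star_self_eq_zero_iff, sub_mul, ← hxk, sub_self]
  have := ρ.word_mem_span hsupp (x := fun _ : Fin 1 => x) (y := Fin.elim0) (fun _ => hx)
    (fun i => i.elim0) hk
  rw [word_eq, leftWord_succ, leftWord_zero, leftWord_zero, map_star, star_star, ← hψ] at this
  exact this

/-- The square of the norm is `‖π(x̂)‖`, `π` is contractive, and `x̂` takes only the values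
`|x(e)|²` and `0`. -/
lemma norm_psi_le {x : C_c(W, ℂ)} (hx : E.SuppInOpenSSection x) {C : ℝ} (hC : 0 ≤ C)
    (h : ∀ e, ‖x e‖ ≤ C) : ‖ρ.ψ x‖ ≤ C := by
  refine abs_le_of_sq_le_sq' ?_ hC |>.2
  rw [sq, ← CStarRing.norm_star_mul_self, ← ρ.map_hat x hx]
  refine (NonUnitalStarAlgHom.norm_apply_le ρ.π _).trans ?_
  rw [← ZeroAtInftyContinuousMap.norm_toBCF_eq_norm,
    BoundedContinuousFunction.norm_le (sq_nonneg C)]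
  intro v
  change ‖E.hatFun x v‖ ≤ _
  rw [hatFun]
  split_ifs with hv
  · rw [Complex.norm_real, norm_pow, norm_norm]
    exact pow_le_pow_left₀ (norm_nonneg _) (h _) 2
  · simpa using sq_nonneg C

lemma psi_mem_closedSpan (h𝓕 : E.IsBaseWithFunctions 𝓑 𝓕)
    (hsupp : ∀ x ∈ 𝓕, E.SuppInOpenSSection x) (x : C_c(W, ℂ)) :
    ρ.ψ x ∈ ρ.closedSpan hsupp := by
  refine compactlySupported_induction (P := fun x => ρ.ψ x ∈ ρ.closedSpan hsupp) ?_ ?_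
    (fun e => ?_) x
  · rw [map_zero]
    exact zero_mem _
  · intro x y hx hy
    rw [map_add]
    exact add_mem hx hy
  · obtain ⟨U, hUo, he, hU⟩ := E.exists_isOpen_isSSection e
    -- Density controls only open supports in `U'`, while the norm bound needs the closed support in
    -- a section; placing `U'` inside a compact subset of `U` bridges the gap.
    obtain ⟨C, hC, heC, hCU⟩ := exists_compact_subset hUo he
    obtain ⟨U', hU', heU', hU'C⟩ := h𝓕.isBasis.exists_subset_of_mem_open heC isOpen_interior
    have hU'o := h𝓕.isBasis.isOpen hU'
    refine ⟨U', hU'o, heU', fun x hx => ?_⟩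
    rw [mem_closedSpan, Metric.mem_closure_iff]
    intro ε hε
    let g : C₀(U', ℂ) := ⟨⟨fun e => x e, (map_continuous x).comp continuous_subtype_val⟩, by
      refine HasCompactSupport.is_zero_at_infty (HasCompactSupport.intro
        (K := ((↑) : U' → W) ⁻¹' tsupport x) ?_
        fun e he => image_eq_zero_of_notMem_tsupport (f := x) he)
      rw [IsEmbedding.subtypeVal.isCompact_iff, Subtype.image_preimage_coe,
        inter_eq_right.2 hx]
      exact x.hasCompactSupport.isCompact⟩
    obtain ⟨h, hh, hhg⟩ := h𝓕.dense_span U' hU' g (ε / 2) (half_pos hε)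
    have hsU {y : C_c(W, ℂ)} (hy : Function.support y ⊆ U') : tsupport y ⊆ U :=
      (closure_minimal (hy.trans (hU'C.trans interior_subset)) hC.isClosed).trans hCU
    -- The approximation is given on `U'` only; off `U'` both `h` and `x` vanish, so the estimate is
    -- global.
    have hhU : ∀ e, e ∉ U' → h e = 0 := by
      intro e he
      clear hhg
      induction hh using Submodule.span_induction with
      | mem y hy => exact not_not.1 fun hye => he (hy.2 hye)
      | zero => rfl
      | add y y' _ _ hy hy' => simp [hy, hy']
      | smul c y _ hy => simp [hy]
    have hxU : ∀ e, e ∉ U' → x e = 0 := fun e he =>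
      not_not.1 fun hxe => he (hx (subset_tsupport _ hxe))
    refine ⟨ρ.ψ h, ?_, ?_⟩
    · clear hhg hhU
      induction hh using Submodule.span_induction with
      | mem y hy => exact ρ.psi_mem_span hsupp hy.1
      | zero => rw [map_zero]; exact zero_mem _
      | add y y' _ _ hy hy' => rw [map_add]; exact add_mem hy hy'
      | smul c y _ hy => rw [map_smul]; exact Submodule.smul_mem _ _ hy
    · rw [dist_comm, dist_eq_norm, ← map_sub]
      refine (ρ.norm_psi_le ⟨U, hUo, hU, hsU fun e hne => ?_⟩ (half_pos hε).le fun e => ?_).trans_lt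
        (half_lt_self hε)
      · by_contra he
        exact hne (by simp [hhU e he, hxU e he])
      · by_cases he : e ∈ U'
        · exact (hhg ⟨e, he⟩).le
        · simpa [hhU e he, hxU e he] using (half_pos hε).le

lemma leftWord_mem (S : NonUnitalStarSubalgebra ℂ B) (hS : ∀ x, ρ.ψ x ∈ S) {n : ℕ}
    (x : Fin n → C_c(W, ℂ)) {b : B} (hb : b ∈ S) : ρ.leftWord x b ∈ S := by
  induction n with
  | zero => simpa using hb
  | succ n ih =>
    rw [leftWord_succ]
    exact mul_mem (hS _) (ih _)

lemma word_mem_cstar {n m : ℕ} (x : Fin n → C_c(W, ℂ)) (f : C₀(V, ℂ)) (y : Fin m → C_c(W, ℂ)) :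
    ρ.word x f y ∈ ρ.cstar := by
  have hle : NonUnitalStarAlgebra.adjoin ℂ (range ρ.ψ ∪ range ρ.π) ≤ ρ.cstar :=
    NonUnitalStarSubalgebra.le_topologicalClosure _
  have hψ (x) : ρ.ψ x ∈ ρ.cstar :=
    hle (NonUnitalStarAlgebra.subset_adjoin ℂ _ (Or.inl ⟨x, rfl⟩))
  have hπ (f) : ρ.π f ∈ ρ.cstar :=
    hle (NonUnitalStarAlgebra.subset_adjoin ℂ _ (Or.inr ⟨f, rfl⟩))
  rw [word_eq]
  exact ρ.leftWord_mem _ hψ _ (star_mem (ρ.leftWord_mem _ hψ _ (hπ _)))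

lemma closure_span_eq_cstar (h𝓕 : E.IsBaseWithFunctions 𝓑 𝓕)
    (hsupp : ∀ x ∈ 𝓕, E.SuppInOpenSSection x) :
    closure (Submodule.span ℂ (ρ.spanningElements 𝓕) : Set B) = (ρ.cstar : Set B) := by
  apply Subset.antisymm
  · refine closure_minimal ?_ (NonUnitalStarSubalgebra.isClosed_topologicalClosure _)
    change Submodule.span ℂ (ρ.spanningElements 𝓕) ≤ ρ.cstar.toSubmodule
    rw [Submodule.span_le]
    rintro _ ⟨n, m, x, f, y, -, rfl⟩
    exact ρ.word_mem_cstar x f y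
  · change ρ.cstar ≤ ρ.closedSpan hsupp
    refine NonUnitalStarSubalgebra.topologicalClosure_minimal _
      (NonUnitalStarAlgebra.adjoin_le ?_) isClosed_closure
    rintro _ (⟨x, rfl⟩ | ⟨f, rfl⟩)
    · exact ρ.psi_mem_closedSpan h𝓕 hsupp x
    · exact ρ.pi_mem_closedSpan hsupp f

end ToeplitzRep

end TopologicalGraph

theorem mainTheorem8 {V W B : Type*}
    [TopologicalSpace V] [LocallyCompactSpace V] [T2Space V]
    [TopologicalSpace W] [LocallyCompactSpace W] [T2Space W]
    [NonUnitalCStarAlgebra B]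
    (E : TopologicalGraph V W) (ρ : E.ToeplitzRep B)
    (𝓑 : Set (Set W)) (𝓕 : Set C_c(W, ℂ)) (h𝓕 : E.IsBaseWithFunctions 𝓑 𝓕)
    (hsupp : ∀ x ∈ 𝓕, E.IsSSection (tsupport x)) :
    closure (Submodule.span ℂ (ρ.spanningElements 𝓕) : Set B) = (ρ.cstar : Set B) ∧
    ∀ (m n l q : ℕ) (w : Fin m → C_c(W, ℂ)) (f : C₀(V, ℂ)) (x : Fin n → C_c(W, ℂ))
      (y : Fin (n + l) → C_c(W, ℂ)) (g : C₀(V, ℂ)) (z : Fin q → C_c(W, ℂ)),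
      E.IsSpanningData 𝓕 w f x → E.IsSpanningData 𝓕 y g z →
      (∃ k : C₀(V, ℂ), ∀ μ : E.Path l,
        (f μ.r * E.H (E.diamond x) (E.diamond fun i => y (Fin.castAdd l i)) μ.r) *
            E.diamond (fun j => y (Fin.natAdd n j)) μ =
          E.diamond (fun j => y (Fin.natAdd n j)) μ * k μ.s) ∧
      ∀ k : C₀(V, ℂ), (∀ μ : E.Path l,
        (f μ.r * E.H (E.diamond x) (E.diamond fun i => y (Fin.castAdd l i)) μ.r) *
            E.diamond (fun j => y (Fin.natAdd n j)) μ =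
          E.diamond (fun j => y (Fin.natAdd n j)) μ * k μ.s) →
        ρ.word w f x * ρ.word y g z =
            ρ.word (Fin.append w fun j => y (Fin.natAdd n j)) (k * g) z ∧
          (ρ.word w f x * ρ.word y g z ≠ 0 →
            ρ.word w f x * ρ.word y g z ∈ ρ.spanningElements 𝓕) := by
  have hS : ∀ x ∈ 𝓕, E.SuppInOpenSSection x := fun x hx =>
    TopologicalGraph.suppInOpenSSection_of_isSSection (hsupp x hx)
  refine ⟨ρ.closure_span_eq_cstar h𝓕 hS, fun m n l q w f x y g z hwx hyz => ?_⟩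
  have hx i := hS _ (hwx.right_mem i)
  have hy i := hS _ (hyz.left_mem i)
  refine ⟨ρ.exists_multiplier hx hy f, fun k hk => ?_⟩
  have h := ρ.word_mul_word w f g z hx hy hk
  refine ⟨h, fun hne => ?_⟩
  rw [h] at hne ⊢
  exact ρ.word_mem_spanningElements hS
    (TopologicalGraph.append_natAdd_mem hwx.left_mem hyz.left_mem) hyz.right_mem
    (hyz.hasCompactSupport.mul_left (f := k)) hne
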